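/- Let $w=(w_n)_{n\ge1}$ be a sequence of positive real numbers, and let $\mathcal H^{w}$ be the Hilbert space of Dirichlet series $f(s)=\sum_{n\ge1}a_nn^{-s}$ with $\|f\|^2=\sum_{n\ge1}|a_n|^2w_n<\infty$. For $\delta\in\mathbb R$ put $\Omega_\delta=\{s\in\mathbb C:\operatorname{Re}s>\delta\}$, and for a natural number $N$ let $\langle P_N\rangle$ be the set of positive integers all of whose prime factors are among the first $N$ primes. If $\sigma_0>0$ is such that $\sum_{n\ge1}w_n^{-1}n^{-2\sigma}<\infty$ for every $\sigma>\sigma_0$, then every $f\in\mathcal H^{w}$ converges absolutely on $\Omega_{\sigma_0}$; a function $\varphi$ on $\Omega_{\sigma_0}$ is a multiplier of $\mathcal H^{w}$ if $\varphi f\in\mathcal H^{w}$ for every $f\in\mathcal H^{w}$, and $M_\varphi f=\varphi f$. Theorem. Let $\Delta\ge0$, and suppose that for each $\sigma>\Delta$ there is a $C_\sigma>0$ such that $w_n^{-1}n^{-2\sigma}\le C_\sigma$ for all $n\ge1$. Then 1. $\sum_{n\ge1}w_n^{-1}n^{-2\sigma'}<\infty$ for every $\sigma'>\Delta+\tfrac12$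 (so that $\sigma_0=\Delta+\tfrac12$ is admissible above); 2. $\sum_{n\in\langle P_N\rangle}w_n^{-1}n^{-2\sigma}<\infty$ for every $N$ and every $\sigma>\Delta$; 3. for every admissible $\sigma_0$ and every multiplier $\varphi$ of $\mathcal H^{w}$, multiplication by $\varphi$ is a (unique) bounded operator $M_\varphi$ on $\mathcal H^{w}$, $\varphi$ is on $\Omega_{\sigma_0}$ the sum of a Dirichlet series that converges (possibly conditionally) at every point of $\Omega_\Delta$, and, with $\varphi$ denoting the sum of this series on $\Omega_\Delta$ as well, $$|\varphi|_{\Omega_\Delta}:=\sup_{s\in\Omega_\Delta}|\varphi(s)|\le\|M_\varphi\|.$$ -/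

import Mathlib

open Filter Topology
open scoped ENNReal ComplexConjugate

/-- A sequence `w₁, w₂, …` of positive real numbers. -/
structure WeightSeq where
  toFun : ℕ+ → ℝ
  pos : ∀ n, 0 < toFun n

instance : CoeFun WeightSeq (fun _ => ℕ+ → ℝ) := ⟨WeightSeq.toFun⟩

/-- The open right half-plane `Ω_δ = {z : Re z > δ}`. -/
def halfPlane (δ : ℝ) : Set ℂ := {z | δ < z.re}

/-- The Dirichlet series `∑ aₙ n^{-s}` converges (possibly only conditionally) at `s`, with
sum `v`. -/
def DirichletConvergesTo (a : ℕ+ → ℂ) (s v : ℂ) : Prop :=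
  Tendsto (fun N : ℕ+ => ∑ n ∈ Finset.Icc 1 N, a n * ((n : ℕ) : ℂ) ^ (-s)) atTop (𝓝 v)

/-- The supremum `|F|_S` of `|F|` on the set `S`, as an extended nonnegative real. -/
noncomputable def supNormOn (S : Set ℂ) (F : ℂ → ℂ) : ℝ≥0∞ := ⨆ s ∈ S, ‖F s‖ₑ

/-- The set `P_N` of the first `N` primes. -/
noncomputable def firstPrimes (N : ℕ) : Finset ℕ := (Finset.range N).image (Nat.nth Nat.Prime)

/-- The set `⟨P_N⟩` of positive integers all of whose prime factors are among the first `N`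
primes. -/
def primeWords (N : ℕ) : Set ℕ+ := {n | (n : ℕ) ∈ Nat.factoredNumbers (firstPrimes N)}

/-- The vector space of coefficient sequences `a` with `∑ |aₙ|² wₙ < ∞`. -/
def weightedL2 (w : WeightSeq) : Submodule ℂ (ℕ+ → ℂ) where
  carrier := {a | Summable fun n => ‖a n‖ ^ 2 * w n}
  zero_mem' := by simp
  add_mem' := by
    intro a b ha hb
    refine Summable.of_nonneg_of_le (fun n => mul_nonneg (sq_nonneg _) (w.pos n).le) (fun n => ?_)
      ((ha.add hb).mul_left 2)
    have h1 : ‖(a + b) n‖ ^ 2 ≤ 2 * (‖a n‖ ^ 2 + ‖b n‖ ^ 2) := by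
      have := norm_add_le (a n) (b n)
      have h0 := norm_nonneg (a n + b n)
      simp only [Pi.add_apply]
      nlinarith [sq_nonneg (‖a n‖ - ‖b n‖)]
    nlinarith [w.pos n]
  smul_mem' := by
    intro c a ha
    refine (Summable.mul_left (‖c‖ ^ 2) ha).congr (fun n => ?_)
    simp only [Pi.smul_apply, norm_smul]
    ring

/-- The space `H^w` of Dirichlet series `∑ aₙ n^{-s}` with `∑ |aₙ|² wₙ < ∞`, an element being
given by its coefficient sequence.  (A separate type, so that it carries the norm topology and
not the topology of pointwise convergence of the coefficients.) -/
def DirichletSpace (w : WeightSeq) : Type := ↥(weightedL2 w)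

namespace DirichletSpace

variable {w : WeightSeq}

instance : AddCommGroup (DirichletSpace w) := inferInstanceAs (AddCommGroup ↥(weightedL2 w))

instance : Module ℂ (DirichletSpace w) := inferInstanceAs (Module ℂ ↥(weightedL2 w))

/-- The coefficients `aₙ` of an element `∑ aₙ n^{-s}` of `H^w`. -/
def coeff (f : DirichletSpace w) : ℕ+ → ℂ := f.1

theorem coeff_add (f g : DirichletSpace w) (n : ℕ+) : (f + g).coeff n = f.coeff n + g.coeff n := rfl

theorem coeff_smul (c : ℂ) (f : DirichletSpace w) (n : ℕ+) : (c • f).coeff n = c * f.coeff n := rfl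

theorem ext_coeff {f g : DirichletSpace w} (h : ∀ n, f.coeff n = g.coeff n) : f = g :=
  Subtype.ext (funext h)

theorem summable_coeff (f : DirichletSpace w) : Summable fun n => ‖f.coeff n‖ ^ 2 * w n := f.2

/-- The function represented by an element of `H^w`.  The series converges absolutely wherever
`∑ wₙ⁻¹ n^{-2 Re s} < ∞`, see `summable_eval`. -/
noncomputable def eval (f : DirichletSpace w) (s : ℂ) : ℂ :=
  ∑' n : ℕ+, f.coeff n * ((n : ℕ) : ℂ) ^ (-s)

theorem summable_eval (f : DirichletSpace w) {s : ℂ}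
    (hs : Summable fun n : ℕ+ => (w n)⁻¹ * ((n : ℕ) : ℝ) ^ (-2 * s.re)) :
    Summable fun n : ℕ+ => ‖f.coeff n * ((n : ℕ) : ℂ) ^ (-s)‖ := by
  refine Summable.of_nonneg_of_le (fun n => norm_nonneg _) (fun n => ?_)
    (f.summable_coeff.add hs)
  have hn : (0 : ℝ) < ((n : ℕ) : ℝ) := by exact_mod_cast n.pos
  have hw := w.pos n
  rw [norm_mul, Complex.norm_natCast_cpow_of_pos n.pos, Complex.neg_re]
  have h2 : ((n : ℕ) : ℝ) ^ (-2 * s.re) = (((n : ℕ) : ℝ) ^ (-s.re)) ^ 2 := by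
    rw [← Real.rpow_natCast, ← Real.rpow_mul hn.le]
    congr 1
    push_cast
    ring
  rw [h2]
  set x := ‖f.coeff n‖
  set y := ((n : ℕ) : ℝ) ^ (-s.re)
  have hx : 0 ≤ x := norm_nonneg _
  have hy : 0 ≤ y := Real.rpow_nonneg hn.le _
  have key : x ^ 2 * w n + (w n)⁻¹ * y ^ 2 - 2 * (x * y) = (w n)⁻¹ * (x * w n - y) ^ 2 := by
    field_simp
    ring
  have h3 : 0 ≤ (w n)⁻¹ * (x * w n - y) ^ 2 := by positivity
  nlinarith [mul_nonneg hx hy]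

theorem summable_inner (f g : DirichletSpace w) :
    Summable fun n => g.coeff n * conj (f.coeff n) * (w n : ℂ) := by
  refine Summable.of_norm_bounded (f.summable_coeff.add g.summable_coeff) (fun n => ?_)
  have hw := w.pos n
  rw [norm_mul, norm_mul, RCLike.norm_conj, Complex.norm_real, Real.norm_of_nonneg hw.le]
  nlinarith [sq_nonneg (‖f.coeff n‖ - ‖g.coeff n‖), mul_nonneg (norm_nonneg (f.coeff n))
    (norm_nonneg (g.coeff n)), mul_nonneg (mul_nonneg (norm_nonneg (f.coeff n))
    (norm_nonneg (g.coeff n))) hw.le]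

/-- The inner product `∑ aₙ conj(bₙ) wₙ`.  Mathlib's inner product is linear in its second
argument, so that `b` are here the coefficients of the first argument. -/
noncomputable def weightedInner (f g : DirichletSpace w) : ℂ :=
  ∑' n, g.coeff n * conj (f.coeff n) * (w n : ℂ)

theorem weightedInner_self (f : DirichletSpace w) :
    weightedInner f f = ((∑' n, ‖f.coeff n‖ ^ 2 * w n : ℝ) : ℂ) := by
  rw [weightedInner, Complex.ofReal_tsum]
  refine tsum_congr (fun n => ?_)
  rw [Complex.mul_conj, Complex.normSq_eq_norm_sq]
  push_cast
  ring

@[reducible]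
noncomputable def innerCore (w : WeightSeq) : InnerProductSpace.Core ℂ (DirichletSpace w) where
  inner := weightedInner
  conj_inner_symm f g := by
    change conj (weightedInner _ _) = weightedInner _ _
    rw [weightedInner, weightedInner, Complex.conj_tsum]
    refine tsum_congr (fun n => ?_)
    simp only [map_mul, Complex.conj_conj, Complex.conj_ofReal]
    ring
  re_inner_nonneg f := by
    change 0 ≤ (weightedInner f f).re
    rw [weightedInner_self]
    simpa using tsum_nonneg (fun n => mul_nonneg (sq_nonneg ‖f.coeff n‖) (w.pos n).le)
  add_left f g h := by
    change weightedInner _ _ = weightedInner _ _ + weightedInner _ _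
    rw [weightedInner, weightedInner, weightedInner,
      ← (summable_inner f h).tsum_add (summable_inner g h)]
    refine tsum_congr (fun n => ?_)
    rw [coeff_add, map_add]
    ring
  smul_left f g c := by
    change weightedInner _ _ = _ * weightedInner _ _
    rw [weightedInner, weightedInner, ← tsum_mul_left]
    refine tsum_congr (fun n => ?_)
    rw [coeff_smul, map_mul]
    ring
  definite f hf := by
    change weightedInner f f = 0 at hf
    rw [weightedInner_self, Complex.ofReal_eq_zero] at hf
    have h0 := (hasSum_zero_iff_of_nonneg
      (fun n => mul_nonneg (sq_nonneg ‖f.coeff n‖) (w.pos n).le)).1 (hf ▸ f.summable_coeff.hasSum)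
    refine ext_coeff (fun n => ?_)
    have h1 := congrFun h0 n
    simp only [Pi.zero_apply, mul_eq_zero, (w.pos n).ne', or_false] at h1
    have h2 : f.coeff n = 0 := by simpa using h1
    rw [h2]
    rfl

noncomputable instance : NormedAddCommGroup (DirichletSpace w) :=
  (innerCore w).toNormedAddCommGroup

noncomputable instance : InnerProductSpace ℂ (DirichletSpace w) :=
  InnerProductSpace.ofCore (innerCore w).toCore

theorem inner_def (f g : DirichletSpace w) :
    inner ℂ f g = ∑' n, g.coeff n * conj (f.coeff n) * (w n : ℂ) := rfl

theorem norm_sq_eq (f : DirichletSpace w) : ‖f‖ ^ 2 = ∑' n, ‖f.coeff n‖ ^ 2 * w n := by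
  have h : inner ℂ f f = ((∑' n, ‖f.coeff n‖ ^ 2 * w n : ℝ) : ℂ) := weightedInner_self f
  rw [inner_self_eq_norm_sq_to_K (𝕜 := ℂ) f] at h
  refine Complex.ofReal_injective (Eq.trans ?_ h)
  push_cast
  rfl

/-- The isometry `(aₙ) ↦ (√wₙ aₙ)` of `H^w` onto `ℓ²`. -/
noncomputable def toL2 (w : WeightSeq) :
    DirichletSpace w ≃ₗᵢ[ℂ] lp (fun _ : ℕ+ => ℂ) 2 where
  toFun f := ⟨fun n => (Real.sqrt (w n) : ℂ) * f.coeff n, by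
    refine memℓp_gen (f.summable_coeff.congr (fun n => ?_))
    rw [norm_mul, Complex.norm_real, Real.norm_of_nonneg (Real.sqrt_nonneg _)]
    simp [mul_pow, Real.sq_sqrt (w.pos n).le, mul_comm]⟩
  map_add' f g := by
    refine Subtype.ext (funext (fun n => ?_))
    exact mul_add _ _ _
  map_smul' c f := by
    refine Subtype.ext (funext (fun n => ?_))
    exact mul_left_comm _ _ _
  invFun x := ⟨fun n => ((Real.sqrt (w n))⁻¹ : ℂ) * x n, by
    have hx : Summable fun n => ‖x n‖ ^ 2 := by
      simpa using (lp.memℓp x).summable (by norm_num)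
    refine hx.congr (fun n => ?_)
    have hw := w.pos n
    rw [norm_mul, norm_inv, Complex.norm_real, Real.norm_of_nonneg (Real.sqrt_nonneg _), mul_pow,
      inv_pow, Real.sq_sqrt hw.le]
    field_simp⟩
  left_inv f := by
    refine ext_coeff (fun n => ?_)
    have h : (Real.sqrt (w n) : ℂ) ≠ 0 :=
      Complex.ofReal_ne_zero.2 (Real.sqrt_ne_zero'.2 (w.pos n))
    exact inv_mul_cancel_left₀ h _
  right_inv x := by
    refine Subtype.ext (funext (fun n => ?_))
    have h : (Real.sqrt (w n) : ℂ) ≠ 0 :=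
      Complex.ofReal_ne_zero.2 (Real.sqrt_ne_zero'.2 (w.pos n))
    exact mul_inv_cancel_left₀ h _
  norm_map' f := by
    refine (sq_eq_sq₀ (norm_nonneg _) (norm_nonneg _)).1 ?_
    rw [norm_sq_eq]
    have h := lp.norm_rpow_eq_tsum (p := 2) (by norm_num)
      (⟨fun n => (Real.sqrt (w n) : ℂ) * f.coeff n, by
        refine memℓp_gen (f.summable_coeff.congr (fun n => ?_))
        rw [norm_mul, Complex.norm_real, Real.norm_of_nonneg (Real.sqrt_nonneg _)]
        simp [mul_pow, Real.sq_sqrt (w.pos n).le, mul_comm]⟩ : lp (fun _ : ℕ+ => ℂ) 2)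
    simp only [ENNReal.toReal_ofNat, Real.rpow_ofNat] at h
    refine h.trans (tsum_congr (fun n => ?_))
    rw [norm_mul, Complex.norm_real, Real.norm_of_nonneg (Real.sqrt_nonneg _), mul_pow,
      Real.sq_sqrt (w.pos n).le, mul_comm]

instance : CompleteSpace (DirichletSpace w) :=
  (toL2 w).toIsometryEquiv.completeSpace

end DirichletSpace

/-- `φ` is a multiplier of `H^w`, regarded as a space of functions on `Ω_{σ₀}`: for each `f` in
`H^w` the function `φ f` on `Ω_{σ₀}` is in `H^w`.  Only the values of `φ` on `Ω_{σ₀}` matter. -/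
def IsMultiplier (w : WeightSeq) (σ₀ : ℝ) (φ : ℂ → ℂ) : Prop :=
  ∀ f : DirichletSpace w, ∃ g : DirichletSpace w,
    ∀ s ∈ halfPlane σ₀, g.eval s = φ s * f.eval s

/-- The bounded operator `M` on `H^w` is the operator `M_φ` of multiplication by `φ`. -/
def IsMultiplicationOperator (w : WeightSeq) (σ₀ : ℝ) (φ : ℂ → ℂ)
    (M : DirichletSpace w →L[ℂ] DirichletSpace w) : Prop :=
  ∀ f : DirichletSpace w, ∀ s ∈ halfPlane σ₀, (M f).eval s = φ s * f.eval s

/-! The boundedness of `M` as an operator controls finitely many primes at a time. Let `a` be the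
coefficients of `M 1`; on `Ω_{σ₀}` they sum to `φ`. On `⟨P_N⟩` the Euler product needs only an
arbitrarily small positive exponent to converge, so for `Re s > Δ` the evaluation at `s` of the part
with indices in `⟨P_N⟩` is given by some `k` in `H^w`. Since `⟨P_N⟩` is closed under products and
divisors, restricting to it respects Dirichlet convolution. Hence `⟨k, M k⟩ = φ_N(s) ⟨k, k⟩`, where
`φ_N` is the restriction of `∑ aₙ n^{-s}` to `⟨P_N⟩`, and `|φ_N(s)| ≤ ‖M‖` throughout `Ω_Δ`,
uniformly in `N` (`norm_lseries_indicator_le`).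

It remains to let `N → ∞`, where absolute convergence is lost. Integrating `φ_N` along a vertical
line against a kernel whose cosine transform is a trapezoid cuts the series off exactly at `n ≤ x`.
The kernel has `L¹` norm `O(x^ε)`, so the partial sums of all the `φ_N` are `O(x^ε)` with one
constant (`norm_sum_term_le_of_norm_LSeries_le`). For `N` large in terms of `x` they are the partial
sums of the full series. Summation by parts gives its convergence slightly to the right, and
dominated convergence of the summed-by-parts series gives `φ_N(s) → φ(s)`, so the bound survives
(`exists_tendsto_sum_term_of_norm_LSeries_indicator_le`). -/

/-! ### The trapezoid kernel and its `L¹` norm. -/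

open MeasureTheory in
theorem integrable_one_sub_cos_div_sq :
    Integrable fun t : ℝ => (1 - Real.cos t) / t ^ 2 := by
  refine (integrable_inv_one_add_sq.const_mul 3).mono'
    (Measurable.aestronglyMeasurable (by fun_prop)) (Eventually.of_forall fun t => ?_)
  have h1 : 0 ≤ 1 - Real.cos t := by linarith [Real.cos_le_one t]
  rw [Real.norm_of_nonneg (by positivity)]
  rcases eq_or_ne t 0 with rfl | ht
  · simp
  have h2 := Real.one_sub_sq_div_two_le_cos (x := t)
  have h3 := Real.neg_one_le_cos t
  rw [← div_eq_mul_inv, div_le_div_iff₀ (by positivity) (by positivity)]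
  nlinarith [sq_nonneg t]

/-- The constant `∫ (1 - cos t) / t ^ 2 dt`. -/
noncomputable def oneSubCosIntegral : ℝ := ∫ t : ℝ, (1 - Real.cos t) / t ^ 2

-- The constant only normalises the kernel, so its exact value is not needed, only that it can be
-- divided by.
open MeasureTheory in
theorem oneSubCosIntegral_pos : 0 < oneSubCosIntegral := by
  have hnn : 0 ≤ fun t : ℝ => (1 - Real.cos t) / t ^ 2 := fun t =>
    div_nonneg (by linarith [Real.cos_le_one t]) (sq_nonneg t)
  rw [oneSubCosIntegral, integral_pos_iff_support_of_nonneg hnn integrable_one_sub_cos_div_sq]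
  refine lt_of_lt_of_le ?_ (measure_mono (s := Set.Ioo (0 : ℝ) 1) fun t ht => ?_)
  · simp
  · have h1 : Real.cos t ≠ 1 := by
      intro h
      have := (Real.cos_eq_one_iff_of_lt_of_lt (by linarith [ht.1, Real.pi_gt_three])
        (by linarith [ht.2, Real.pi_gt_three])).1 h
      exact ht.1.ne' this
    exact div_ne_zero (sub_ne_zero.2 h1.symm) (pow_ne_zero 2 ht.1.ne')

open MeasureTheory in
theorem integrable_one_sub_cos_mul_div_sq (u : ℝ) :
    Integrable fun t : ℝ => (1 - Real.cos (u * t)) / t ^ 2 := by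
  rcases eq_or_ne u 0 with rfl | hu
  · simp
  refine ((integrable_one_sub_cos_div_sq.comp_mul_left' hu).const_mul (u ^ 2)).congr
    (Eventually.of_forall fun t => ?_)
  rcases eq_or_ne t 0 with rfl | ht
  · simp
  simp only
  field_simp

open MeasureTheory in
theorem integral_one_sub_cos_mul_div_sq (u : ℝ) :
    ∫ t : ℝ, (1 - Real.cos (u * t)) / t ^ 2 = |u| * oneSubCosIntegral := by
  rcases eq_or_ne u 0 with rfl | hu
  · simp
  have h := Measure.integral_comp_mul_left (fun t : ℝ => (1 - Real.cos t) / t ^ 2) u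
  rw [smul_eq_mul, ← oneSubCosIntegral] at h
  have h2 : |u| * oneSubCosIntegral = u ^ 2 * (|u⁻¹| * oneSubCosIntegral) := by
    rw [abs_inv, ← sq_abs]
    have := abs_ne_zero.2 hu
    field_simp
  rw [h2, ← h, ← integral_const_mul]
  refine integral_congr_ae (Eventually.of_forall fun t => ?_)
  rcases eq_or_ne t 0 with rfl | ht
  · simp
  simp only
  field_simp

/-- The kernel whose cosine transform is the trapezoid function that is `1` on `[-L, L]`, `0`
outside `[-L - h, L + h]`, and linear in between. -/
noncomputable def trapezoidKernel (L h t : ℝ) : ℝ :=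
  (Real.cos (L * t) - Real.cos ((L + h) * t)) / (oneSubCosIntegral * h * t ^ 2)

open MeasureTheory in
theorem integrable_trapezoidKernel (L h : ℝ) : Integrable (trapezoidKernel L h) := by
  refine (((integrable_one_sub_cos_mul_div_sq (L + h)).sub
    (integrable_one_sub_cos_mul_div_sq L)).const_mul (oneSubCosIntegral * h)⁻¹).congr
    (Eventually.of_forall fun t => ?_)
  simp only [Pi.sub_apply, trapezoidKernel, ← sub_div]
  rw [inv_mul_eq_div, div_div, mul_comm (t ^ 2)]
  congr 1
  ring

open MeasureTheory in
theorem integral_trapezoidKernel_mul_cos (L h u : ℝ) :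
    ∫ t : ℝ, trapezoidKernel L h t * Real.cos (u * t) =
      (|u + L + h| + |u - L - h| - |u + L| - |u - L|) / (2 * h) := by
  have hc := oneSubCosIntegral_pos.ne'
  set q : ℝ → ℝ → ℝ := fun v t => (1 - Real.cos (v * t)) / t ^ 2 with hq
  have hi : ∀ v, Integrable (q v) := integrable_one_sub_cos_mul_div_sq
  have hv : ∀ v, ∫ t, q v t = |v| * oneSubCosIntegral := integral_one_sub_cos_mul_div_sq
  -- Product-to-sum formulas for cosines; each resulting piece integrates to a multiple of an
  -- absolute value.
  have key : ∀ t, trapezoidKernel L h t * Real.cos (u * t) = (2 * oneSubCosIntegral * h)⁻¹ *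
      (((q (u + L + h) t + q (u - L - h) t) - q (u + L) t) - q (u - L) t) := by
    intro t
    have e1 : (u + L + h) * t = u * t + (L + h) * t := by ring
    have e2 : (u - L - h) * t = u * t - (L + h) * t := by ring
    simp only [hq, ← sub_div, ← add_div]
    rw [e1, e2, add_mul u L, sub_mul u L, Real.cos_add, Real.cos_sub, Real.cos_add, Real.cos_sub,
      trapezoidKernel, inv_mul_eq_div, div_div, mul_comm (t ^ 2), div_mul_eq_mul_div,
      mul_assoc (2 : ℝ), mul_assoc (2 : ℝ), ← div_div _ 2]
    congr 1
    ring
  have i2 : Integrable fun t => q (u + L + h) t + q (u - L - h) t := (hi _).add (hi _)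
  have i3 : Integrable fun t => q (u + L + h) t + q (u - L - h) t - q (u + L) t := i2.sub (hi _)
  simp_rw [key]
  rw [integral_const_mul, integral_sub i3 (hi _), integral_sub i2 (hi _),
    integral_add (hi _) (hi _), hv, hv, hv, hv]
  rcases eq_or_ne h 0 with rfl | hh
  · simp
  field_simp

/-- For `|t| ≤ 1` both sines are bounded by their arguments. For `|t| ≥ 1` the first is bounded by
`1` and the second by `(B|t|)^(1-η)`, an interpolation between `1` and `B|t|` that leaves an
integrable power of `t`. The `4` comes from `1 + |t| ≤ 2` or `1 + |t| ≤ 2|t|`, with `1 + η ≤ 2`. -/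
theorem abs_sin_mul_abs_sin_div_sq_le {A B η : ℝ} (hA : 0 ≤ A) (hB : 0 ≤ B) (hB1 : B ≤ 1)
    (h0 : 0 < η) (h1 : η < 1) (t : ℝ) :
    |Real.sin (A * t)| * |Real.sin (B * t)| / t ^ 2 ≤
      (1 + A) * B ^ (1 - η) * 4 * (1 + ‖t‖) ^ (-(1 + η)) := by
  rcases eq_or_ne t 0 with rfl | ht
  · simp; positivity
  have ht0 : 0 < |t| := abs_pos.2 ht
  rw [Real.norm_eq_abs, ← sq_abs t]
  have hs : ∀ y : ℝ, |Real.sin (y * t)| ≤ |y| * |t| := fun y => by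
    rw [← abs_mul]; exact Real.abs_sin_le_abs
  have hBp : 0 ≤ B ^ (1 - η) := Real.rpow_nonneg hB _
  have hsB : |Real.sin (B * t)| ≤ (B * |t|) ^ (1 - η) := by
    have h2 : |Real.sin (B * t)| ≤ B * |t| := by simpa [abs_of_nonneg hB] using hs B
    rcases le_total (B * |t|) 1 with h | h
    · refine h2.trans ?_
      exact Real.self_le_rpow_of_le_one (by positivity) h (by linarith)
    · exact (Real.abs_sin_le_one _).trans (Real.one_le_rpow h (by linarith))
  rcases le_total |t| 1 with h | h
  · have hq : (1 : ℝ) ≤ 4 * (1 + |t|) ^ (-(1 + η)) := by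
      have : (2 : ℝ) ^ (-(2 : ℝ)) ≤ (1 + |t|) ^ (-(1 + η)) := by
        calc (2 : ℝ) ^ (-(2 : ℝ)) ≤ (2 : ℝ) ^ (-(1 + η)) :=
              Real.rpow_le_rpow_of_exponent_le (by norm_num) (by linarith)
          _ ≤ _ := Real.rpow_le_rpow_of_nonpos (by positivity) (by linarith) (by linarith)
      rw [Real.rpow_neg (by norm_num)] at this
      have h4 : ((2 : ℝ) ^ (2 : ℝ))⁻¹ = 1 / 4 := by norm_num
      linarith
    have hBB : B ≤ B ^ (1 - η) := Real.self_le_rpow_of_le_one hB hB1 (by linarith)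
    calc |Real.sin (A * t)| * |Real.sin (B * t)| / |t| ^ 2
        ≤ (|A| * |t|) * (|B| * |t|) / |t| ^ 2 := by gcongr <;> exact hs _
      _ = A * B := by rw [abs_of_nonneg hA, abs_of_nonneg hB]; field_simp
      _ ≤ (1 + A) * B ^ (1 - η) * 1 := by
          rw [mul_one]; gcongr; linarith
      _ ≤ (1 + A) * B ^ (1 - η) * (4 * (1 + |t|) ^ (-(1 + η))) := by gcongr
      _ = _ := by ring
  · have hq : |t| ^ (-(1 + η)) ≤ 4 * (1 + |t|) ^ (-(1 + η)) := by
      have h3 : (2 * |t|) ^ (-(1 + η)) ≤ (1 + |t|) ^ (-(1 + η)) :=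
        Real.rpow_le_rpow_of_nonpos (by positivity) (by linarith) (by linarith)
      have h4 : (4 : ℝ)⁻¹ ≤ 2 ^ (-(1 + η)) := by
        calc (4 : ℝ)⁻¹ = (2 : ℝ) ^ (-(2 : ℝ)) := by
              rw [Real.rpow_neg (by norm_num)]; norm_num
          _ ≤ _ := Real.rpow_le_rpow_of_exponent_le (by norm_num) (by linarith)
      rw [Real.mul_rpow (by norm_num) ht0.le] at h3
      have h5 : 0 ≤ |t| ^ (-(1 + η)) := by positivity
      nlinarith
    calc |Real.sin (A * t)| * |Real.sin (B * t)| / |t| ^ 2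
        ≤ 1 * (B * |t|) ^ (1 - η) / |t| ^ 2 := by
          gcongr; exact Real.abs_sin_le_one _
      _ = B ^ (1 - η) * |t| ^ (-(1 + η)) := by
          rw [one_mul, Real.mul_rpow hB ht0.le, mul_div_assoc, ← Real.rpow_natCast |t| 2,
            ← Real.rpow_sub ht0]
          congr 2
          push_cast
          ring
      _ ≤ B ^ (1 - η) * (4 * (1 + |t|) ^ (-(1 + η))) := by gcongr
      _ ≤ (1 + A) * (B ^ (1 - η) * (4 * (1 + |t|) ^ (-(1 + η)))) :=
          le_mul_of_one_le_left (by positivity) (by linarith)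
      _ = _ := by ring

/-- The difference of cosines is a product of sines at the frequencies `L + h/2` and `h/2`; the
factor `h^(1-η)` from the second almost cancels the `h` in the denominator. -/
theorem abs_trapezoidKernel_le {L h η : ℝ} (hL : 0 ≤ L) (hh : 0 < h) (hh1 : h ≤ 1)
    (h0 : 0 < η) (h1 : η < 1) (t : ℝ) :
    |trapezoidKernel L h t| ≤
      8 / oneSubCosIntegral * (2 + L) * h ^ (-η) * (1 + ‖t‖) ^ (-(1 + η)) := by
  have hc := oneSubCosIntegral_pos
  have h2 := abs_sin_mul_abs_sin_div_sq_le (A := L + h / 2) (B := h / 2) (by positivity)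
    (by positivity) (by linarith) h0 h1 t
  have e : trapezoidKernel L h t = 2 / (oneSubCosIntegral * h) *
      (Real.sin ((L + h / 2) * t) * Real.sin (h / 2 * t) / t ^ 2) := by
    have e1 : (L * t + (L + h) * t) / 2 = (L + h / 2) * t := by ring
    have e2 : (L * t - (L + h) * t) / 2 = -(h / 2 * t) := by ring
    rw [trapezoidKernel, Real.cos_sub_cos, e1, e2, Real.sin_neg, div_mul_div_comm]
    congr 1
    ring
  rw [e, abs_mul, abs_div _ (t ^ 2), abs_mul (Real.sin _), abs_of_nonneg (sq_nonneg t),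
    abs_of_nonneg (by positivity)]
  refine (mul_le_mul_of_nonneg_left h2 (by positivity)).trans ?_
  have h3 : (h / 2) ^ (1 - η) ≤ h * h ^ (-η) := by
    calc (h / 2) ^ (1 - η) ≤ h ^ (1 - η) :=
          Real.rpow_le_rpow (by positivity) (by linarith) (by linarith)
      _ = _ := by rw [sub_eq_add_neg, Real.rpow_add hh, Real.rpow_one]
  calc 2 / (oneSubCosIntegral * h) * ((1 + (L + h / 2)) * (h / 2) ^ (1 - η) * 4 *
        (1 + ‖t‖) ^ (-(1 + η)))
      ≤ 2 / (oneSubCosIntegral * h) * ((2 + L) * (h * h ^ (-η)) * 4 *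
        (1 + ‖t‖) ^ (-(1 + η))) := by
        have : 1 + (L + h / 2) ≤ 2 + L := by linarith
        gcongr
    _ = _ := by field_simp; ring

open MeasureTheory in
theorem exists_integral_abs_trapezoidKernel_le {ε : ℝ} (h0 : 0 < ε) (h1 : ε < 1) :
    ∃ D, 0 ≤ D ∧ ∀ x : ℕ, 1 ≤ x →
      ∫ t, |trapezoidKernel (Real.log x) (1 / (x + 1)) t| ≤ D * (x : ℝ) ^ ε := by
  -- Half of `ε` pays for `log x`, the other half for `h^(-η) = (x+1)^η`.
  set η := ε / 2 with hη
  have hη0 : 0 < η := by positivity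
  have hη1 : η < 1 := by linarith
  set J : ℝ := ∫ t : ℝ, (1 + ‖t‖) ^ (-(1 + η))
  have hJi : Integrable fun t : ℝ => (1 + ‖t‖) ^ (-(1 + η)) :=
    integrable_one_add_norm (by simp [hη0])
  have hJ : 0 ≤ J := integral_nonneg fun t => by positivity
  have hc := oneSubCosIntegral_pos
  refine ⟨8 / oneSubCosIntegral * (2 + 1 / η) * 2 ^ η * J, by positivity, fun x hx => ?_⟩
  have hx1 : (1 : ℝ) ≤ x := by exact_mod_cast hx
  have hx0 : (0 : ℝ) < x := by linarith
  have hL : 0 ≤ Real.log x := Real.log_nonneg hx1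
  have hh1 : (1 : ℝ) / (x + 1) ≤ 1 := by rw [div_le_one (by positivity)]; linarith
  calc ∫ t, |trapezoidKernel (Real.log x) (1 / (x + 1)) t|
      ≤ ∫ t, 8 / oneSubCosIntegral * (2 + Real.log x) * (1 / (x + 1) : ℝ) ^ (-η) *
        (1 + ‖t‖) ^ (-(1 + η)) := by
        refine integral_mono (integrable_trapezoidKernel _ _).abs (hJi.const_mul _) fun t => ?_
        exact abs_trapezoidKernel_le hL (by positivity) hh1 hη0 hη1 t
    _ = 8 / oneSubCosIntegral * (2 + Real.log x) * (1 / (x + 1) : ℝ) ^ (-η) * J :=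
        integral_const_mul _ _
    _ ≤ 8 / oneSubCosIntegral * ((2 + 1 / η) * (x : ℝ) ^ η) * (2 ^ η * (x : ℝ) ^ η) * J := by
        have hp : 1 ≤ (x : ℝ) ^ η := Real.one_le_rpow hx1 hη0.le
        have hl := Real.log_le_rpow_div hx0.le hη0
        gcongr
        · rw [add_mul, one_div_mul_eq_div]
          linarith
        · rw [one_div, Real.inv_rpow (by positivity), Real.rpow_neg (by positivity), inv_inv,
            ← Real.mul_rpow (by norm_num) hx0.le]
          exact Real.rpow_le_rpow (by positivity) (by linarith) hη0.le
    _ = _ := by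
        have : (x : ℝ) ^ ε = (x : ℝ) ^ η * (x : ℝ) ^ η := by
          rw [← Real.rpow_add hx0]; congr 1; rw [hη]; ring
        rw [this]; ring

theorem trapezoid_eq_one {L h u : ℝ} (hh : 0 < h) (hu : 0 ≤ u) (huL : u ≤ L) :
    (|u + L + h| + |u - L - h| - |u + L| - |u - L|) / (2 * h) = 1 := by
  rw [abs_of_nonneg (by linarith : 0 ≤ u + L + h), abs_of_nonpos (by linarith : u - L - h ≤ 0),
    abs_of_nonneg (by linarith : 0 ≤ u + L), abs_of_nonpos (by linarith : u - L ≤ 0),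
    div_eq_one_iff_eq (by positivity)]
  ring

theorem trapezoid_eq_zero {L h u : ℝ} (hh : 0 < h) (hL : 0 ≤ L) (huL : L + h ≤ u) :
    (|u + L + h| + |u - L - h| - |u + L| - |u - L|) / (2 * h) = 0 := by
  rw [abs_of_nonneg (by linarith : 0 ≤ u + L + h), abs_of_nonneg (by linarith : 0 ≤ u - L - h),
    abs_of_nonneg (by linarith : 0 ≤ u + L), abs_of_nonneg (by linarith : 0 ≤ u - L)]
  ring

/-- The slope of the trapezoid fits between `log x` and `log (x+1)`, because `log ((x+1)/x) ≥
1/(x+1)`; no integer sees an intermediate value. -/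
theorem trapezoid_log_natCast {x n : ℕ} (hx : 1 ≤ x) (hn : n ≠ 0) :
    (|Real.log n + Real.log x + 1 / (x + 1)| + |Real.log n - Real.log x - 1 / (x + 1)| -
      |Real.log n + Real.log x| - |Real.log n - Real.log x|) / (2 * (1 / (x + 1))) =
      if n ≤ x then 1 else 0 := by
  have hx0 : (0 : ℝ) < x := by exact_mod_cast hx
  have hn0 : (0 : ℝ) < n := by exact_mod_cast Nat.pos_of_ne_zero hn
  split_ifs with h
  · exact trapezoid_eq_one (by positivity) (Real.log_natCast_nonneg n)
      (Real.log_le_log hn0 (by exact_mod_cast h))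
  · refine trapezoid_eq_zero (by positivity) (Real.log_natCast_nonneg x) ?_
    have h1 : (x : ℝ) + 1 ≤ n := by exact_mod_cast not_le.1 h
    have h2 : Real.log (x + 1) ≤ Real.log n := Real.log_le_log (by positivity) h1
    have h3 := Real.one_sub_inv_le_log_of_pos (x := ((x : ℝ) + 1) / x) (by positivity)
    rw [Real.log_div (by positivity) hx0.ne'] at h3
    have h4 : 1 - (((x : ℝ) + 1) / x)⁻¹ = 1 / (x + 1) := by field_simp; ring
    linarith

/-! ### Partial sums from bounds on a vertical line. -/

theorem LSeries.term_add_mul_I (b : ℕ → ℂ) (s : ℂ) (t : ℝ) (n : ℕ) :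
    LSeries.term b (s + t * Complex.I) n =
      LSeries.term b s n * Complex.exp (-(Real.log n * t * Complex.I)) := by
  rcases eq_or_ne n 0 with rfl | hn
  · simp
  have hn' : (n : ℂ) ≠ 0 := Nat.cast_ne_zero.2 hn
  rw [LSeries.term_of_ne_zero hn, LSeries.term_of_ne_zero hn, Complex.cpow_add _ _ hn',
    Complex.exp_neg, Complex.cpow_def_of_ne_zero hn' (t * Complex.I), Complex.natCast_log,
    div_mul_eq_div_div, mul_assoc, ← div_eq_mul_inv]

/-- Averaging over `t` and `-t` turns the oscillating factor into a cosine, so that the real cosine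
transform of the kernel suffices. -/
theorem LSeries.term_add_mul_I_symm (b : ℕ → ℂ) (s : ℂ) (t : ℝ) (n : ℕ) :
    (LSeries.term b (s + t * Complex.I) n + LSeries.term b (s + (-t : ℝ) * Complex.I) n) / 2 =
      LSeries.term b s n * (Real.cos (Real.log n * t) : ℂ) := by
  rw [LSeries.term_add_mul_I, LSeries.term_add_mul_I, Complex.ofReal_cos, Complex.cos]
  push_cast
  ring_nf

theorem LSeriesSummable.add_mul_I {b : ℕ → ℂ} {s : ℂ} (hb : LSeriesSummable b s) (t : ℝ) :
    LSeriesSummable b (s + t * Complex.I) :=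
  (LSeriesSummable_iff_of_re_eq_re (by simp)).1 hb

open MeasureTheory in
/-- The partial sums of an absolutely convergent Dirichlet series that is bounded by `K` on a
vertical line, on that line. -/
theorem norm_sum_term_le_of_norm_LSeries_le {b : ℕ → ℂ} {s : ℂ} {K : ℝ}
    (hb : LSeriesSummable b s) (hK : ∀ t : ℝ, ‖LSeries b (s + t * Complex.I)‖ ≤ K)
    {x : ℕ} (hx : 1 ≤ x) :
    ‖∑ n ∈ Finset.range (x + 1), LSeries.term b s n‖ ≤
      K * ∫ t, |trapezoidKernel (Real.log x) (1 / (x + 1)) t| := by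
  set k : ℝ → ℝ := trapezoidKernel (Real.log x) (1 / (x + 1)) with hk
  have hki : Integrable k := integrable_trapezoidKernel _ _
  set F : ℕ → ℝ → ℂ := fun n t =>
    LSeries.term b s n * ((k t * Real.cos (Real.log n * t) : ℝ) : ℂ) with hF
  have hkc : ∀ n : ℕ, Integrable fun t => k t * Real.cos (Real.log n * t) := fun n =>
    hki.mul_bdd (c := 1) (by fun_prop) (Eventually.of_forall fun t => by
      simpa using Real.abs_cos_le_one _)
  have hFi : ∀ n, Integrable (F n) := fun n => (hkc n).ofReal.const_mul _
  have hFn : ∀ n t, ‖F n t‖ ≤ ‖LSeries.term b s n‖ * |k t| := fun n t => by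
    simp only [hF, norm_mul, Complex.norm_real, Real.norm_eq_abs]
    gcongr
    exact mul_le_of_le_one_right (abs_nonneg _) (Real.abs_cos_le_one _)
  have hFs : Summable fun n => ∫ t, ‖F n t‖ := by
    refine Summable.of_nonneg_of_le (fun n => integral_nonneg fun t => norm_nonneg _) (fun n => ?_)
      (hb.norm.mul_right (∫ t, |k t|))
    rw [← integral_const_mul]
    exact integral_mono (hFi n).norm (hki.abs.const_mul _) (hFn n)
  have hsum := hasSum_integral_of_summable_integral_norm hFi hFs
  -- The cosine transform at `log n` is the sharp cutoff; the index `0` is harmless since its term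
  -- vanishes.
  have hterm : ∀ n, ∫ t, F n t = if n ∈ Finset.range (x + 1) then LSeries.term b s n else 0 := by
    intro n
    rcases eq_or_ne n 0 with rfl | hn
    · simp [hF]
    simp only [hF]
    rw [integral_const_mul, integral_complex_ofReal, hk, integral_trapezoidKernel_mul_cos,
      trapezoid_log_natCast hx hn]
    by_cases h : n ≤ x
    · simp [h, Nat.lt_succ_of_le h]
    · simp [h]
  simp_rw [hterm] at hsum
  have hfin := (hasSum_sum_of_ne_finset_zero (s := Finset.range (x + 1))
    (fun n hn => if_neg hn)).unique hsum
  rw [Finset.sum_congr rfl fun n hn => if_pos hn] at hfin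
  rw [hfin, ← integral_const_mul]
  refine norm_integral_le_of_norm_le (hki.abs.const_mul K) (Eventually.of_forall fun t => ?_)
  have h1 : ∑' n, F n t = k t * ((LSeries b (s + t * Complex.I) +
      LSeries b (s + (-t : ℝ) * Complex.I)) / 2) := by
    rw [LSeries, LSeries, ← (hb.add_mul_I t).tsum_add (hb.add_mul_I (-t)), ← tsum_div_const,
      ← tsum_mul_left]
    refine tsum_congr fun n => ?_
    rw [LSeries.term_add_mul_I_symm]
    simp only [hF]
    push_cast
    ring
  rw [h1, norm_mul, norm_div, Complex.norm_real, Real.norm_eq_abs, mul_comm]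
  gcongr
  rw [Complex.norm_ofNat, div_le_iff₀ two_pos]
  exact (norm_add_le _ _).trans (by linarith [hK t, hK (-t)])

/-! ### Summation by parts. -/

theorem sum_range_mul_eq_abel (c w : ℕ → ℂ) (x : ℕ) :
    ∑ n ∈ Finset.range (x + 1), c n * w n =
      (∑ n ∈ Finset.range (x + 1), c n) * w (x + 1) +
        ∑ n ∈ Finset.range (x + 1), (∑ i ∈ Finset.range (n + 1), c i) * (w n - w (n + 1)) := by
  induction x with
  | zero => simp; ring
  | succ x ih =>
    rw [Finset.sum_range_succ, ih, Finset.sum_range_succ _ (x + 1), Finset.sum_range_succ _ (x + 1)]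
    rw [Finset.sum_range_succ c (x + 1)]
    ring

theorem rpow_neg_sub_rpow_neg_le {δ : ℝ} (hδ : 0 < δ) {n : ℕ} (hn : n ≠ 0) :
    |(n : ℝ) ^ (-δ) - ((n + 1 : ℕ) : ℝ) ^ (-δ)| ≤ δ * (n : ℝ) ^ (-δ - 1) := by
  have hn0 : (0 : ℝ) < n := by exact_mod_cast Nat.pos_of_ne_zero hn
  have h1 : ((n + 1 : ℕ) : ℝ) ^ (-δ) ≤ (n : ℝ) ^ (-δ) :=
    Real.rpow_le_rpow_of_nonpos hn0 (by push_cast; linarith) (by linarith)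
  rw [abs_of_nonneg (by linarith)]
  have h2 : ((n + 1 : ℕ) : ℝ) = n * (1 + 1 / n) := by push_cast; field_simp
  have hp : (0 : ℝ) < 1 + 1 / n := by positivity
  -- Bernoulli's inequality for a negative exponent, from `1 + y ≤ exp y` and `log (1 + 1/n) ≤ 1/n`.
  have h3 : 1 - δ * (1 / n) ≤ (1 + 1 / n : ℝ) ^ (-δ) := by
    rw [Real.rpow_def_of_pos hp]
    have h4 := Real.log_le_sub_one_of_pos hp
    have h5 := Real.add_one_le_exp (Real.log (1 + 1 / n : ℝ) * -δ)
    nlinarith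
  rw [h2, Real.mul_rpow hn0.le hp.le, Real.rpow_sub_one hn0.ne']
  have h6 : 0 < (n : ℝ) ^ (-δ) := by positivity
  have h7 := mul_le_mul_of_nonneg_left h3 h6.le
  calc _ ≤ (n : ℝ) ^ (-δ) - (n : ℝ) ^ (-δ) * (1 - δ * (1 / n)) := by linarith
    _ = _ := by ring

section Abel

variable {c : ℕ → ℂ} {B ε δ : ℝ}

theorem norm_abel_term_le (hδ : ε < δ) (hε : 0 < ε) (hc0 : c 0 = 0)
    (hc : ∀ x : ℕ, 1 ≤ x → ‖∑ n ∈ Finset.range (x + 1), c n‖ ≤ B * (x : ℝ) ^ ε) (n : ℕ) :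
    ‖(∑ i ∈ Finset.range (n + 1), c i) *
      (((n : ℝ) ^ (-δ) : ℝ) - (((n + 1 : ℕ) : ℝ) ^ (-δ) : ℝ) : ℂ)‖ ≤
      B * δ * (1 / (n : ℝ) ^ (1 + (δ - ε))) := by
  rcases eq_or_ne n 0 with rfl | hn
  -- The bound is `0` here by division by zero, which is why `c 0 = 0` is required.
  · simp [hc0, Real.zero_rpow (by linarith : 1 + (δ - ε) ≠ 0)]
  have hn0 : (0 : ℝ) < n := by exact_mod_cast Nat.pos_of_ne_zero hn
  rw [norm_mul, ← Complex.ofReal_sub, Complex.norm_real, Real.norm_eq_abs]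
  refine (mul_le_mul (hc n (Nat.one_le_iff_ne_zero.2 hn))
    (rpow_neg_sub_rpow_neg_le (hε.trans hδ) hn) (abs_nonneg _) ?_).trans_eq ?_
  · exact (norm_nonneg _).trans (hc n (Nat.one_le_iff_ne_zero.2 hn))
  · rw [one_div, ← Real.rpow_neg hn0.le, mul_mul_mul_comm, ← Real.rpow_add hn0]
    congr 2
    ring

theorem summable_abel_bound (hδ : ε < δ) :
    Summable fun n : ℕ => B * δ * (1 / (n : ℝ) ^ (1 + (δ - ε))) :=
  (Real.summable_one_div_nat_rpow.2 (by linarith)).mul_left _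

/-- The boundary term is `O(x^(ε-δ))`. Writing the limit as the absolutely convergent series of Abel
terms, with a majorant depending only on `B`, `δ` and `ε`, permits dominated convergence in a
further parameter. -/
theorem tendsto_sum_mul_rpow_neg (hδ : ε < δ) (hε : 0 < ε) (hc0 : c 0 = 0)
    (hc : ∀ x : ℕ, 1 ≤ x → ‖∑ n ∈ Finset.range (x + 1), c n‖ ≤ B * (x : ℝ) ^ ε) :
    Tendsto (fun x : ℕ => ∑ n ∈ Finset.range (x + 1), c n * (((n : ℝ) ^ (-δ) : ℝ) : ℂ)) atTop
      (𝓝 (∑' n : ℕ, (∑ i ∈ Finset.range (n + 1), c i) *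
        (((n : ℝ) ^ (-δ) : ℝ) - (((n + 1 : ℕ) : ℝ) ^ (-δ) : ℝ) : ℂ))) := by
  have hsum := (Summable.of_norm_bounded (summable_abel_bound hδ)
    (norm_abel_term_le hδ hε hc0 hc)).hasSum.tendsto_sum_nat.comp (tendsto_add_atTop_nat 1)
  have hz : Tendsto (fun x : ℕ => (∑ n ∈ Finset.range (x + 1), c n) *
      ((((x + 1 : ℕ) : ℝ) ^ (-δ) : ℝ) : ℂ)) atTop (𝓝 0) := by
    have hlim : Tendsto (fun x : ℕ => B * (x : ℝ) ^ (-(δ - ε))) atTop (𝓝 0) := by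
      simpa using ((tendsto_rpow_neg_atTop (sub_pos.2 hδ)).comp
        tendsto_natCast_atTop_atTop).const_mul B
    refine squeeze_zero_norm' ?_ hlim
    filter_upwards [eventually_ge_atTop 1] with x hx
    have hx0 : (0 : ℝ) < x := by exact_mod_cast hx
    have h0 : 0 ≤ B * (x : ℝ) ^ ε := (norm_nonneg _).trans (hc x hx)
    rw [norm_mul, Complex.norm_real, Real.norm_of_nonneg (by positivity)]
    calc _ ≤ B * (x : ℝ) ^ ε * (x : ℝ) ^ (-δ) := by
          refine mul_le_mul (hc x hx) ?_ (by positivity) h0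
          exact Real.rpow_le_rpow_of_nonpos hx0 (by push_cast; linarith) (by linarith)
      _ = _ := by rw [mul_assoc, ← Real.rpow_add hx0]; congr 2; ring
  have h := hz.add hsum
  rw [zero_add] at h
  refine h.congr fun x => ?_
  exact (sum_range_mul_eq_abel c (fun n => (((n : ℝ) ^ (-δ) : ℝ) : ℂ)) x).symm

end Abel

theorem LSeries.term_eq_term_sub_mul_rpow (a : ℕ → ℂ) (s : ℂ) {δ : ℝ} (hδ : δ ≠ 0) (n : ℕ) :
    LSeries.term a s n = LSeries.term a (s - δ) n * (((n : ℝ) ^ (-δ) : ℝ) : ℂ) := by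
  rcases eq_or_ne n 0 with rfl | hn
  · simp
  have hn' : (n : ℂ) ≠ 0 := Nat.cast_ne_zero.2 hn
  rw [LSeries.term_of_ne_zero hn, LSeries.term_of_ne_zero hn, Complex.cpow_sub _ _ hn',
    Complex.ofReal_cpow (Nat.cast_nonneg n), Complex.ofReal_neg, Complex.ofReal_natCast,
    Complex.cpow_neg]
  have := (Complex.cpow_ne_zero_iff_of_exponent_ne_zero (x := n) (y := (δ : ℂ))
    (by exact_mod_cast hδ)).2 hn'
  have h2 : (n : ℂ) ^ s ≠ 0 := by simp [Complex.cpow_eq_zero_iff, hn']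
  field_simp

/-- If the restrictions of a Dirichlet series to an exhausting family of index sets converge
absolutely and are bounded by `K` on `Re s > Δ`, then the whole series converges there, to a sum
that is bounded by `K`. -/
theorem exists_tendsto_sum_term_of_norm_LSeries_indicator_le {Δ K : ℝ} {a : ℕ → ℂ}
    {A : ℕ → Set ℕ} (hA : ∀ x, ∀ᶠ N in atTop, ∀ n ≤ x, n ≠ 0 → n ∈ A N)
    (hsum : ∀ N, ∀ s : ℂ, Δ < s.re → LSeriesSummable ((A N).indicator a) s)
    (hK : ∀ N, ∀ s : ℂ, Δ < s.re → ‖LSeries ((A N).indicator a) s‖ ≤ K)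
    {s : ℂ} (hs : Δ < s.re) :
    ∃ v, Tendsto (fun x : ℕ => ∑ n ∈ Finset.range (x + 1), LSeries.term a s n) atTop (𝓝 v) ∧
      ‖v‖ ≤ K := by
  -- The shift `δ` keeps `s - δ` inside `Re > Δ`, where partial sums are estimated; growth `x^ε`
  -- with `ε < δ` is then absorbed on returning to `s`.
  obtain ⟨δ, hδ0, hδ⟩ := exists_between (sub_pos.2 hs)
  obtain ⟨ε, hε0, hε⟩ := exists_between (lt_min hδ0 one_pos)
  obtain ⟨hεδ, hε1⟩ := lt_min_iff.1 hε
  have hK0 : 0 ≤ K := (norm_nonneg _).trans (hK 0 s hs)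
  have hre : ∀ t : ℝ, Δ < (s - δ + t * Complex.I).re := fun t => by simp; linarith
  have hre0 : Δ < (s - δ).re := by simp; linarith
  obtain ⟨D, hD0, hD⟩ := exists_integral_abs_trapezoidKernel_le hε0 hε1
  have hcN : ∀ N x : ℕ, 1 ≤ x → ‖∑ n ∈ Finset.range (x + 1),
      LSeries.term ((A N).indicator a) (s - δ) n‖ ≤ K * D * (x : ℝ) ^ ε := fun N x hx => by
    refine (norm_sum_term_le_of_norm_LSeries_le (hsum N _ hre0)
      (fun t => hK N _ (hre t)) hx).trans ?_
    rw [mul_assoc]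
    exact mul_le_mul_of_nonneg_left (hD x hx) hK0
  have hev : ∀ x, ∀ᶠ N in atTop, ∑ n ∈ Finset.range (x + 1),
      LSeries.term ((A N).indicator a) (s - δ) n =
      ∑ n ∈ Finset.range (x + 1), LSeries.term a (s - δ) n := fun x => by
    filter_upwards [hA x] with N hN
    refine Finset.sum_congr rfl fun n hn => ?_
    rcases eq_or_ne n 0 with rfl | hn0
    · simp
    rw [LSeries.term_of_ne_zero hn0, LSeries.term_of_ne_zero hn0,
      Set.indicator_of_mem (hN n (Nat.le_of_lt_succ (Finset.mem_range.1 hn)) hn0)]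
  have hc : ∀ x : ℕ, 1 ≤ x → ‖∑ n ∈ Finset.range (x + 1), LSeries.term a (s - δ) n‖ ≤
      K * D * (x : ℝ) ^ ε := fun x hx => by
    obtain ⟨N, hN⟩ := (hev x).exists
    rw [← hN]
    exact hcN N x hx
  refine ⟨_, (tendsto_sum_mul_rpow_neg hεδ hε0 (LSeries.term_zero _ _) hc).congr fun x =>
    Finset.sum_congr rfl fun n _ => (LSeries.term_eq_term_sub_mul_rpow a s hδ0.ne' n).symm, ?_⟩
  have hlim : Tendsto (fun N => LSeries ((A N).indicator a) s) atTop
      (𝓝 (∑' n : ℕ, (∑ i ∈ Finset.range (n + 1), LSeries.term a (s - δ) i) *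
        (((n : ℝ) ^ (-δ) : ℝ) - (((n + 1 : ℕ) : ℝ) ^ (-δ) : ℝ) : ℂ))) := by
    have heq : ∀ N, LSeries ((A N).indicator a) s = ∑' n : ℕ, (∑ i ∈ Finset.range (n + 1),
        LSeries.term ((A N).indicator a) (s - δ) i) *
        (((n : ℝ) ^ (-δ) : ℝ) - (((n + 1 : ℕ) : ℝ) ^ (-δ) : ℝ) : ℂ) := fun N => by
      refine tendsto_nhds_unique ((hsum N s hs).hasSum.tendsto_sum_nat.comp
        (tendsto_add_atTop_nat 1)) ?_
      refine (tendsto_sum_mul_rpow_neg hεδ hε0 (LSeries.term_zero _ _) (hcN N)).congr fun x =>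
        Finset.sum_congr rfl fun n _ => (LSeries.term_eq_term_sub_mul_rpow _ s hδ0.ne' n).symm
    simp_rw [heq]
    -- Each Abel term is eventually constant in `N`, and the majorant does not depend on `N`.
    refine tendsto_tsum_of_dominated_convergence (summable_abel_bound hεδ) (fun n => ?_)
      (Eventually.of_forall fun N => norm_abel_term_le hεδ hε0 (LSeries.term_zero _ _) (hcN N))
    refine tendsto_const_nhds.congr' ?_
    filter_upwards [hev n] with N hN
    rw [hN]
  exact le_of_tendsto hlim.norm (Eventually.of_forall fun N => hK N s hs)

/-! ### Transfer between `ℕ+` and `ℕ`. -/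

/-- The extension by zero of a sequence on the positive integers to the natural numbers. -/
def natExt (a : ℕ+ → ℂ) (n : ℕ) : ℂ := if h : 0 < n then a ⟨n, h⟩ else 0

theorem natExt_coe (a : ℕ+ → ℂ) (n : ℕ+) : natExt a n = a n := dif_pos n.pos

theorem term_natExt (a : ℕ+ → ℂ) (s : ℂ) (n : ℕ+) :
    LSeries.term (natExt a) s n = a n * ((n : ℕ) : ℂ) ^ (-s) := by
  rw [LSeries.term_of_ne_zero n.ne_zero, natExt_coe, Complex.cpow_neg, div_eq_mul_inv]

theorem support_term_subset_range_coe (b : ℕ → ℂ) (s : ℂ) :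
    Function.support (LSeries.term b s) ⊆ Set.range ((↑) : ℕ+ → ℕ) := fun n hn =>
  ⟨⟨n, Nat.pos_of_ne_zero fun h => hn (by rw [h, LSeries.term_zero])⟩, rfl⟩

theorem lseriesSummable_natExt {a : ℕ+ → ℂ} {s : ℂ} :
    LSeriesSummable (natExt a) s ↔ Summable fun n : ℕ+ => a n * ((n : ℕ) : ℂ) ^ (-s) := by
  rw [LSeriesSummable, ← PNat.coe_injective.summable_iff fun n hn =>
    Function.notMem_support.1 fun h => hn (support_term_subset_range_coe _ _ h)]
  exact summable_congr (term_natExt a s)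

theorem lseries_natExt (a : ℕ+ → ℂ) (s : ℂ) :
    LSeries (natExt a) s = ∑' n : ℕ+, a n * ((n : ℕ) : ℂ) ^ (-s) := by
  rw [LSeries, ← PNat.coe_injective.tsum_eq (support_term_subset_range_coe _ _)]
  exact tsum_congr (term_natExt a s)

theorem sum_Icc_eq_sum_range_term (a : ℕ+ → ℂ) (s : ℂ) (N : ℕ+) :
    ∑ n ∈ Finset.Icc 1 N, a n * ((n : ℕ) : ℂ) ^ (-s) =
      ∑ n ∈ Finset.range ((N : ℕ) + 1), LSeries.term (natExt a) s n := by
  refine Finset.sum_of_injOn (fun n : ℕ+ => (n : ℕ)) (PNat.coe_injective.injOn) ?_ ?_ ?_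
  · intro n hn
    simp only [Finset.coe_Icc, Set.mem_Icc] at hn
    simpa [Nat.lt_succ_iff] using hn.2
  · intro n hn hn'
    rcases Nat.eq_zero_or_pos n with rfl | h
    · simp
    · refine absurd ⟨⟨n, h⟩, ?_, rfl⟩ hn'
      exact Finset.mem_coe.2 (Finset.mem_Icc.2
        ⟨one_le, PNat.coe_le_coe _ _ |>.1 (Nat.le_of_lt_succ (Finset.mem_range.1 hn))⟩)
  · exact fun n _ => (term_natExt a s n).symm

theorem dirichletConvergesTo_of_tendsto {a : ℕ+ → ℂ} {s v : ℂ}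
    (h : Tendsto (fun x : ℕ => ∑ n ∈ Finset.range (x + 1), LSeries.term (natExt a) s n) atTop
      (𝓝 v)) : DirichletConvergesTo a s v := by
  have hc : Tendsto ((↑) : ℕ+ → ℕ) atTop atTop := tendsto_atTop.2 fun b =>
    (eventually_ge_atTop (⟨b + 1, b.succ_pos⟩ : ℕ+)).mono fun n hn =>
      (Nat.le_succ b).trans (PNat.coe_le_coe _ _ |>.2 hn)
  exact (h.comp hc).congr fun N => (sum_Icc_eq_sum_range_term a s N).symm

/-! ### Restriction to integers with finitely many prime factors allowed. -/

theorem indicator_natExt (S : Set ℕ) (a : ℕ+ → ℂ) :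
    S.indicator (natExt a) = natExt ((((↑) : ℕ+ → ℕ) ⁻¹' S).indicator a) := by
  funext n
  rcases Nat.eq_zero_or_pos n with rfl | hn
  · simp [natExt]
  lift n to ℕ+ using hn
  rw [natExt_coe]
  by_cases hS : (n : ℕ) ∈ S
  · rw [Set.indicator_of_mem hS, natExt_coe,
      Set.indicator_of_mem (show n ∈ ((↑) : ℕ+ → ℕ) ⁻¹' S from hS)]
  · rw [Set.indicator_of_notMem hS,
      Set.indicator_of_notMem (show n ∉ ((↑) : ℕ+ → ℕ) ⁻¹' S from hS)]

open scoped LSeries.notation in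
/-- Restriction to a set of integers that is closed under products and divisors is compatible with
the Dirichlet convolution. -/
theorem indicator_convolution {S : Set ℕ} (hS : ∀ m n, m ≠ 0 → n ≠ 0 → (m * n ∈ S ↔ m ∈ S ∧ n ∈ S))
    (a b : ℕ → ℂ) : S.indicator (a ⍟ b) = S.indicator a ⍟ S.indicator b := by
  funext n
  simp only [LSeries.convolution_def]
  have key : ∀ p ∈ n.divisorsAntidiagonal, (n ∈ S ↔ p.1 ∈ S ∧ p.2 ∈ S) := fun p hp => by
    have h0 := Nat.ne_zero_of_mem_divisorsAntidiagonal hp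
    rw [← hS _ _ h0.1 h0.2, (Nat.mem_divisorsAntidiagonal.1 hp).1]
  by_cases hn : n ∈ S
  · rw [Set.indicator_of_mem hn]
    refine Finset.sum_congr rfl fun p hp => ?_
    obtain ⟨h1, h2⟩ := (key p hp).1 hn
    rw [Set.indicator_of_mem h1, Set.indicator_of_mem h2]
  · rw [Set.indicator_of_notMem hn]
    refine (Finset.sum_eq_zero fun p hp => ?_).symm
    by_cases h1 : p.1 ∈ S
    · rw [Set.indicator_of_notMem (fun h2 => hn ((key p hp).2 ⟨h1, h2⟩)), mul_zero]
    · rw [Set.indicator_of_notMem h1, zero_mul]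

theorem mul_mem_factoredNumbers_iff (s : Finset ℕ) (m n : ℕ) :
    m * n ∈ Nat.factoredNumbers s ↔ m ∈ Nat.factoredNumbers s ∧ n ∈ Nat.factoredNumbers s :=
  ⟨fun h => ⟨Nat.mem_factoredNumbers_of_dvd h (Nat.dvd_mul_right m n),
    Nat.mem_factoredNumbers_of_dvd h (Nat.dvd_mul_left n m)⟩,
    fun h => Nat.mul_mem_factoredNumbers h.1 h.2⟩

theorem eventually_mem_factoredNumbers_firstPrimes (x : ℕ) :
    ∀ᶠ N in atTop, ∀ n ≤ x, n ≠ 0 → n ∈ Nat.factoredNumbers (firstPrimes N) := by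
  filter_upwards [eventually_gt_atTop x] with N hN n hn hn0
  refine Nat.mem_factoredNumbers.2 ⟨hn0, fun p hp => ?_⟩
  have hpp := Nat.prime_of_mem_primeFactorsList hp
  have hpn := Nat.le_of_mem_primeFactorsList hp
  refine Finset.mem_image.2 ⟨Nat.count Nat.Prime p, Finset.mem_range.2 ?_, Nat.nth_count hpp⟩
  -- The number of primes below `p` is at most `p ≤ x < N`; this crude count is enough.
  exact (Nat.count_le _).trans_lt ((hpn.trans hn).trans_lt hN)

/-- A finite Euler product of convergent geometric series, so any positive exponent suffices, in
contrast to the exponent above `1` needed over all integers. -/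
theorem summable_factoredNumbers_rpow_neg (s : Finset ℕ) {ε : ℝ} (hε : 0 < ε) :
    Summable fun n : Nat.factoredNumbers s => ((n : ℕ) : ℝ) ^ (-ε) := by
  let f : ℕ →* ℝ :=
    { toFun n := (n : ℝ) ^ (-ε)
      map_one' := by simp
      map_mul' m n := by push_cast; exact Real.mul_rpow (Nat.cast_nonneg m) (Nat.cast_nonneg n) }
  refine ((EulerProduct.summable_and_hasSum_factoredNumbers_prod_filter_prime_geometric (f := f)
    (fun {p} hp => ?_) s).1).of_norm
  change ‖(p : ℝ) ^ (-ε)‖ < 1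
  rw [Real.norm_of_nonneg (by positivity)]
  exact Real.rpow_lt_one_of_one_lt_of_neg (by exact_mod_cast hp.one_lt) (by linarith)

/-! ### Summability of the inverse weights. -/

namespace WeightSeq

variable (w : WeightSeq)

theorem inv_mul_rpow_le {C σ σ' : ℝ} {n : ℕ+} (hC : (w n)⁻¹ * ((n : ℕ) : ℝ) ^ (-2 * σ) ≤ C) :
    (w n)⁻¹ * ((n : ℕ) : ℝ) ^ (-2 * σ') ≤ C * ((n : ℕ) : ℝ) ^ (-(2 * (σ' - σ))) := by
  have hn : (0 : ℝ) < ((n : ℕ) : ℝ) := by exact_mod_cast n.pos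
  calc _ = (w n)⁻¹ * ((n : ℕ) : ℝ) ^ (-2 * σ) * ((n : ℕ) : ℝ) ^ (-(2 * (σ' - σ))) := by
        rw [mul_assoc, ← Real.rpow_add hn]
        congr 2
        ring
    _ ≤ _ := by gcongr

theorem inv_mul_rpow_nonneg (σ : ℝ) (n : ℕ+) : 0 ≤ (w n)⁻¹ * ((n : ℕ) : ℝ) ^ (-2 * σ) :=
  mul_nonneg (inv_nonneg.2 (w.pos n).le) (Real.rpow_nonneg (Nat.cast_nonneg _) _)

variable {w} {Δ : ℝ}
  (hw : ∀ σ > Δ, ∃ C > 0, ∀ n : ℕ+, (w n)⁻¹ * ((n : ℕ) : ℝ) ^ (-2 * σ) ≤ C)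

include hw

theorem summable_inv_mul_rpow {σ' : ℝ} (h : Δ + 1 / 2 < σ') :
    Summable fun n : ℕ+ => (w n)⁻¹ * ((n : ℕ) : ℝ) ^ (-2 * σ') := by
  -- The gap `σ' - σ > 1/2` leaves a power of `n` with exponent below `-1`.
  obtain ⟨σ, h1, h2⟩ := exists_between (show Δ < σ' - 1 / 2 by linarith)
  obtain ⟨C, -, hC⟩ := hw σ h1
  refine Summable.of_nonneg_of_le (w.inv_mul_rpow_nonneg σ')
    (fun n => w.inv_mul_rpow_le (hC n)) (Summable.mul_left C ?_)
  exact (Real.summable_nat_rpow.2 (by linarith)).comp_injective PNat.coe_injective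

theorem summable_primeWords (N : ℕ) {σ' : ℝ} (h : Δ < σ') :
    Summable fun n : primeWords N => (w n)⁻¹ * (((n : ℕ+) : ℕ) : ℝ) ^ (-2 * σ') := by
  obtain ⟨σ, h1, h2⟩ := exists_between h
  obtain ⟨C, -, hC⟩ := hw σ h1
  let i : primeWords N → Nat.factoredNumbers (firstPrimes N) := fun n => ⟨((n : ℕ+) : ℕ), n.2⟩
  have hi : Function.Injective i := fun m n hmn => by
    have h : ((m : ℕ+) : ℕ) = ((n : ℕ+) : ℕ) := Subtype.mk.inj hmn
    exact Subtype.ext (PNat.eq h)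
  have hs := (summable_factoredNumbers_rpow_neg (firstPrimes N) (ε := 2 * (σ' - σ))
    (by linarith)).comp_injective hi
  exact Summable.of_nonneg_of_le (fun n => w.inv_mul_rpow_nonneg σ' (n : ℕ+))
    (fun n => w.inv_mul_rpow_le (hC (n : ℕ+))) (hs.mul_left C)

end WeightSeq

/-! ### Evaluation kernels and multiplication operators. -/

namespace DirichletSpace

variable {w : WeightSeq} {S : Set ℕ} {s : ℂ}

theorem eval_eq_lseries (f : DirichletSpace w) (s : ℂ) : f.eval s = LSeries (natExt f.coeff) s :=
  (lseries_natExt _ _).symm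

variable (w S s) in
/-- The squares of the coefficients of the point evaluation at `s`, restricted to `S`, are
summable with the weights of the dual space. -/
def KernelSummable : Prop :=
  Summable ((((↑) : ℕ+ → ℕ) ⁻¹' S).indicator
    fun n : ℕ+ => (w n)⁻¹ * ((n : ℕ) : ℝ) ^ (-2 * s.re))

theorem norm_natCast_cpow_neg_sq (s : ℂ) (n : ℕ+) :
    ‖((n : ℕ) : ℂ) ^ (-s)‖ ^ 2 = ((n : ℕ) : ℝ) ^ (-2 * s.re) := by
  rw [Complex.norm_natCast_cpow_of_pos n.pos, Complex.neg_re, ← Real.rpow_natCast,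
    ← Real.rpow_mul (Nat.cast_nonneg _)]
  congr 1
  push_cast
  ring

/-- The element of `H^w` that represents the evaluation at `s` of the part of a Dirichlet series
with indices in `S`. -/
noncomputable def kernel (hs : KernelSummable w S s) : DirichletSpace w :=
  ⟨(((↑) : ℕ+ → ℕ) ⁻¹' S).indicator fun n => ((w n)⁻¹ : ℝ) * conj (((n : ℕ) : ℂ) ^ (-s)), by
    refine hs.congr fun n => ?_
    by_cases hn : n ∈ ((↑) : ℕ+ → ℕ) ⁻¹' S
    · rw [Set.indicator_of_mem hn, Set.indicator_of_mem hn, norm_mul, Complex.norm_real,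
        RCLike.norm_conj, Real.norm_of_nonneg (inv_nonneg.2 (w.pos n).le), mul_pow,
        norm_natCast_cpow_neg_sq]
      have := (w.pos n).ne'
      field_simp
    · rw [Set.indicator_of_notMem hn, Set.indicator_of_notMem hn]
      simp⟩

theorem coeff_kernel (hs : KernelSummable w S s) : (kernel hs).coeff =
    (((↑) : ℕ+ → ℕ) ⁻¹' S).indicator fun n => ((w n)⁻¹ : ℝ) * conj (((n : ℕ) : ℂ) ^ (-s)) := rfl

theorem coeff_mul_conj_coeff_kernel (hs : KernelSummable w S s) (f : DirichletSpace w) (n : ℕ+) :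
    f.coeff n * conj ((kernel hs).coeff n) * (w n : ℂ) =
      (((↑) : ℕ+ → ℕ) ⁻¹' S).indicator f.coeff n * ((n : ℕ) : ℂ) ^ (-s) := by
  rw [coeff_kernel]
  by_cases hn : n ∈ ((↑) : ℕ+ → ℕ) ⁻¹' S
  · have : (w n : ℂ) ≠ 0 := Complex.ofReal_ne_zero.2 (w.pos n).ne'
    rw [Set.indicator_of_mem hn, Set.indicator_of_mem hn, map_mul, Complex.conj_conj,
      Complex.conj_ofReal, Complex.ofReal_inv]
    field_simp
  · rw [Set.indicator_of_notMem hn, Set.indicator_of_notMem hn]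
    simp

theorem lseriesSummable_indicator (hs : KernelSummable w S s) (f : DirichletSpace w) :
    LSeriesSummable (S.indicator (natExt f.coeff)) s := by
  rw [indicator_natExt, lseriesSummable_natExt]
  exact (summable_inner (kernel hs) f).congr (coeff_mul_conj_coeff_kernel hs f)

theorem inner_kernel (hs : KernelSummable w S s) (f : DirichletSpace w) :
    inner ℂ (kernel hs) f = LSeries (S.indicator (natExt f.coeff)) s := by
  rw [indicator_natExt, lseries_natExt, inner_def]
  exact tsum_congr (coeff_mul_conj_coeff_kernel hs f)

theorem kernel_ne_zero (hs : KernelSummable w S s) (h1 : 1 ∈ S) : kernel hs ≠ 0 := by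
  intro h
  have h2 : (kernel hs).coeff 1 = 0 := by rw [h]; rfl
  rw [coeff_kernel, Set.indicator_of_mem (by simpa using h1)] at h2
  simp [(w.pos 1).ne'] at h2

theorem kernelSummable_univ
    (h : Summable fun n : ℕ+ => (w n)⁻¹ * ((n : ℕ) : ℝ) ^ (-2 * s.re)) :
    KernelSummable w Set.univ s := by
  simpa [KernelSummable] using h

/-- The Dirichlet series `1`. -/
noncomputable def one (w : WeightSeq) : DirichletSpace w :=
  ⟨Pi.single 1 1, summable_of_ne_finset_zero (s := {1}) fun n hn => by
    rw [Finset.mem_singleton] at hn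
    simp [Pi.single_eq_of_ne hn]⟩

theorem eval_one (s : ℂ) : (one w).eval s = 1 := by
  rw [eval, tsum_eq_single 1 fun n hn => ?_]
  · simp [one, coeff]
  · simp [one, coeff, Pi.single_eq_of_ne hn]

section Abscissa

variable {σ₀ : ℝ} (hσ : ∀ σ > σ₀, Summable fun n : ℕ+ => (w n)⁻¹ * ((n : ℕ) : ℝ) ^ (-2 * σ))

include hσ

theorem lseriesSummable_natExt_coeff (f : DirichletSpace w) (hs : s ∈ halfPlane σ₀) :
    LSeriesSummable (natExt f.coeff) s :=
  lseriesSummable_natExt.2 (f.summable_eval (hσ _ hs)).of_norm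

theorem eval_add (f g : DirichletSpace w) (hs : s ∈ halfPlane σ₀) :
    (f + g).eval s = f.eval s + g.eval s := by
  rw [eval, eval, eval, ← ((f.summable_eval (hσ _ hs)).of_norm).tsum_add
    ((g.summable_eval (hσ _ hs)).of_norm)]
  exact tsum_congr fun n => by rw [coeff_add, add_mul]

omit hσ in
theorem eval_smul (c : ℂ) (f : DirichletSpace w) (s : ℂ) : (c • f).eval s = c * f.eval s := by
  rw [eval, eval, ← tsum_mul_left]
  exact tsum_congr fun n => by rw [coeff_smul, mul_assoc]

theorem continuous_eval (hs : s ∈ halfPlane σ₀) :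
    Continuous fun f : DirichletSpace w => f.eval s := by
  have h : (fun f : DirichletSpace w => f.eval s) =
      fun f => inner ℂ (kernel (kernelSummable_univ (hσ _ hs))) f := by
    funext f
    rw [inner_kernel, Set.indicator_univ, eval_eq_lseries]
  rw [h]
  fun_prop

omit hσ in
-- Uniqueness of Dirichlet coefficients; the index `0` is excluded because `LSeries` ignores it.
theorem eq_of_lseries_eqOn {b c : ℕ → ℂ}
    (hb : ∀ s ∈ halfPlane σ₀, LSeriesSummable b s) (hc : ∀ s ∈ halfPlane σ₀, LSeriesSummable c s)
    (h : ∀ s ∈ halfPlane σ₀, LSeries b s = LSeries c s) {n : ℕ} (hn : n ≠ 0) : b n = c n := by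
  have h1 : ((σ₀ + 1 : ℝ) : ℂ) ∈ halfPlane σ₀ := by simp [halfPlane]
  refine LSeries.eq_of_LSeries_eventually_eq
    ((hb _ h1).abscissaOfAbsConv_le.trans_lt (EReal.coe_lt_top _))
    ((hc _ h1).abscissaOfAbsConv_le.trans_lt (EReal.coe_lt_top _)) ?_ hn
  filter_upwards [eventually_gt_atTop σ₀] with x hx
  exact h x (by simpa [halfPlane] using hx)

theorem ext_eval {f g : DirichletSpace w} (h : ∀ s ∈ halfPlane σ₀, f.eval s = g.eval s) :
    f = g := by
  refine ext_coeff fun n => ?_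
  rw [← natExt_coe f.coeff, ← natExt_coe g.coeff]
  refine eq_of_lseries_eqOn (fun s hs => lseriesSummable_natExt_coeff hσ f hs)
    (fun s hs => lseriesSummable_natExt_coeff hσ g hs) (fun s hs => ?_) n.ne_zero
  rw [← eval_eq_lseries, ← eval_eq_lseries, h s hs]

/-- Closed graph theorem: point evaluations on `Ω_{σ₀}` are continuous and together separate the
elements of `H^w`, which gives linearity, the closed graph and uniqueness. -/
theorem existsUnique_isMultiplicationOperator {φ : ℂ → ℂ} (hφ : IsMultiplier w σ₀ φ) :
    ∃! M : DirichletSpace w →L[ℂ] DirichletSpace w, IsMultiplicationOperator w σ₀ φ M := by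
  choose T hT using hφ
  let T' : DirichletSpace w →ₗ[ℂ] DirichletSpace w :=
    { toFun := T
      map_add' f g := ext_eval hσ fun s hs => by
        rw [hT _ s hs, eval_add hσ _ _ hs, eval_add hσ _ _ hs, hT _ s hs, hT _ s hs, mul_add]
      map_smul' c f := ext_eval hσ fun s hs => by
        rw [hT _ s hs, RingHom.id_apply, eval_smul, eval_smul, hT _ s hs, mul_left_comm] }
  have hg : ∀ (u : ℕ → DirichletSpace w) (x y), Tendsto u atTop (𝓝 x) →
      Tendsto (T' ∘ u) atTop (𝓝 y) → y = T' x := fun u x y hu hTu => ext_eval hσ fun s hs => by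
    have h1 := ((continuous_eval hσ hs).tendsto y).comp hTu
    have h2 := (((continuous_eval hσ hs).tendsto x).comp hu).const_mul (φ s)
    refine (tendsto_nhds_unique h1 (h2.congr fun n => ?_)).trans (hT x s hs).symm
    exact (hT (u n) s hs).symm
  refine ⟨ContinuousLinearMap.ofSeqClosedGraph hg, fun f s hs => hT f s hs, fun M hM => ?_⟩
  refine ContinuousLinearMap.ext fun f => ext_eval hσ fun s hs => ?_
  rw [hM f s hs]
  exact (hT f s hs).symm

variable {φ : ℂ → ℂ} {M : DirichletSpace w →L[ℂ] DirichletSpace w}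
  (hM : IsMultiplicationOperator w σ₀ φ M)

include hM

omit hσ in
theorem eval_map_one (hs : s ∈ halfPlane σ₀) : (M (one w)).eval s = φ s := by
  rw [hM _ s hs, eval_one, mul_one]

open scoped LSeries.notation in
-- The product of functions becomes a convolution of coefficients by uniqueness. This describes `M`
-- without reference to `Ω_{σ₀}`, so it can be used at points outside it.
theorem natExt_coeff_map (f : DirichletSpace w) :
    natExt (M f).coeff = natExt (M (one w)).coeff ⍟ natExt f.coeff := by
  funext n
  rcases eq_or_ne n 0 with rfl | hn
  · simp [natExt]
  have h1 := fun (g : DirichletSpace w) s (hs : s ∈ halfPlane σ₀) =>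
    lseriesSummable_natExt_coeff hσ g hs
  refine eq_of_lseries_eqOn (h1 _) (fun s hs => (h1 _ s hs).convolution (h1 _ s hs))
    (fun s hs => ?_) hn
  rw [LSeries_convolution' (h1 _ s hs) (h1 _ s hs), ← eval_eq_lseries, ← eval_eq_lseries,
    ← eval_eq_lseries, hM f s hs, eval_map_one hM hs]

/-- Compressing a multiplication operator to a set of indices that is closed under products and
divisors, the values of the restricted symbol are eigenvalues of its adjoint. -/
theorem norm_lseries_indicator_le
    (hS : ∀ m n, m ≠ 0 → n ≠ 0 → (m * n ∈ S ↔ m ∈ S ∧ n ∈ S)) (h1 : 1 ∈ S)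
    (hs : KernelSummable w S s) :
    ‖LSeries (S.indicator (natExt (M (one w)).coeff)) s‖ ≤ ‖M‖ := by
  set k := kernel hs with hk
  -- Pairing with `k` evaluates the `S`-part at `s`, and the `S`-part of a convolution is the
  -- convolution of the `S`-parts.
  have h2 : inner ℂ k (M k) = LSeries (S.indicator (natExt (M (one w)).coeff)) s *
      inner ℂ k k := by
    rw [hk, inner_kernel, inner_kernel, natExt_coeff_map hσ hM, indicator_convolution hS,
      LSeries_convolution' (lseriesSummable_indicator hs _) (lseriesSummable_indicator hs _)]
  have hk0 : 0 < ‖k‖ := norm_pos_iff.2 (kernel_ne_zero hs h1)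
  have h3 : ‖inner ℂ k (M k)‖ ≤ ‖M‖ * (‖k‖ * ‖k‖) :=
    (norm_inner_le_norm _ _).trans <| by
      have := M.le_opNorm k
      nlinarith
  have h4 : ‖inner ℂ k k‖ = ‖k‖ * ‖k‖ := by
    rw [inner_self_eq_norm_sq_to_K, norm_pow, RCLike.norm_ofReal, abs_norm, sq]
  rw [h2, norm_mul, h4] at h3
  exact le_of_mul_le_mul_right h3 (by positivity)

end Abscissa

end DirichletSpace

theorem mainTheorem4 (Δ : ℝ) (hΔ : 0 ≤ Δ) (w : WeightSeq)
    (hw : ∀ σ > Δ, ∃ C > 0, ∀ n : ℕ+, (w n)⁻¹ * ((n : ℕ) : ℝ) ^ (-2 * σ) ≤ C) :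
    (∀ σ' > Δ + 1 / 2, Summable fun n : ℕ+ => (w n)⁻¹ * ((n : ℕ) : ℝ) ^ (-2 * σ')) ∧
    (∀ N : ℕ, ∀ σ > Δ,
      Summable fun n : primeWords N => (w n)⁻¹ * (((n : ℕ+) : ℕ) : ℝ) ^ (-2 * σ)) ∧
    ∀ σ₀ : ℝ, 0 < σ₀ →
      (∀ σ > σ₀, Summable fun n : ℕ+ => (w n)⁻¹ * ((n : ℕ) : ℝ) ^ (-2 * σ)) →
      ∀ φ : ℂ → ℂ, IsMultiplier w σ₀ φ →
        (∃! M : DirichletSpace w →L[ℂ] DirichletSpace w, IsMultiplicationOperator w σ₀ φ M) ∧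
        ∀ M : DirichletSpace w →L[ℂ] DirichletSpace w, IsMultiplicationOperator w σ₀ φ M →
          ∃ (a : ℕ+ → ℂ) (Φ : ℂ → ℂ),
            (∀ s ∈ halfPlane σ₀, Φ s = φ s) ∧
            (∀ s ∈ halfPlane σ₀ ∪ halfPlane Δ, DirichletConvergesTo a s (Φ s)) ∧
            supNormOn (halfPlane Δ) Φ ≤ ‖M‖ₑ := by
  refine ⟨fun σ' h => WeightSeq.summable_inv_mul_rpow hw h,
    fun N σ h => WeightSeq.summable_primeWords hw N h, fun σ₀ _ hσ φ hφ =>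
    ⟨DirichletSpace.existsUnique_isMultiplicationOperator hσ hφ, fun M hM => ?_⟩⟩
  -- The series of `φ` is that of `M 1 = φ · 1`.
  set a := (M (DirichletSpace.one w)).coeff with ha
  have hker : ∀ N : ℕ, ∀ s : ℂ, Δ < s.re →
      DirichletSpace.KernelSummable w (Nat.factoredNumbers (firstPrimes N)) s := fun N s hs =>
    summable_subtype_iff_indicator.1 (WeightSeq.summable_primeWords hw N hs)
  have hΔs : ∀ s ∈ halfPlane Δ, ∃ v, DirichletConvergesTo a s v ∧ ‖v‖ ≤ ‖M‖ := fun s hs => by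
    obtain ⟨v, hv, hvM⟩ := exists_tendsto_sum_term_of_norm_LSeries_indicator_le
      (A := fun N => Nat.factoredNumbers (firstPrimes N)) (a := natExt a) (K := ‖M‖)
      eventually_mem_factoredNumbers_firstPrimes
      (fun N s hs => DirichletSpace.lseriesSummable_indicator (hker N s hs) _)
      (fun N s hs => DirichletSpace.norm_lseries_indicator_le hσ hM
        (fun m n _ _ => mul_mem_factoredNumbers_iff _ m n) (by simp [Nat.mem_factoredNumbers])
        (hker N s hs)) hs
    exact ⟨v, dirichletConvergesTo_of_tendsto hv, hvM⟩
  have hσs : ∀ s ∈ halfPlane σ₀, DirichletConvergesTo a s (φ s) := fun s hs => by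
    refine dirichletConvergesTo_of_tendsto ?_
    rw [← DirichletSpace.eval_map_one hM hs, DirichletSpace.eval_eq_lseries]
    exact (DirichletSpace.lseriesSummable_natExt_coeff hσ _ hs).hasSum.tendsto_sum_nat.comp
      (tendsto_add_atTop_nat 1)
  -- Either half-plane may be the larger one, so `Φ` is taken as the pointwise sum on the union;
  -- uniqueness of limits identifies it on each.
  have hex : ∀ s ∈ halfPlane σ₀ ∪ halfPlane Δ, ∃ v, DirichletConvergesTo a s v := by
    rintro s (hs | hs)
    · exact ⟨_, hσs s hs⟩
    · exact ⟨_, (hΔs s hs).choose_spec.1⟩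
  choose! Φ hΦ using hex
  refine ⟨a, Φ, fun s hs => tendsto_nhds_unique (hΦ s (Or.inl hs)) (hσs s hs), hΦ,
    iSup₂_le fun s hs => ?_⟩
  obtain ⟨v, hv, hvM⟩ := hΔs s hs
  rw [tendsto_nhds_unique (hΦ s (Or.inr hs)) hv]
  exact enorm_le_iff_norm_le.2 hvM
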